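/- **Setting.** Let $\mathcal S,\mathcal X,\mathcal Y,\widehat{\mathcal S}$ be finite alphabets ($\mathcal X,\widehat{\mathcal S}$ non-empty), $P_S$ a probability distribution on $\mathcal S$, $P_{Y|X}$ a channel, $d:\mathcal S\times\widehat{\mathcal S}\to[0,\infty]$ a distortion function, $\mathbf d\in[0,\infty)$, and $\kappa(s,x,y,\widehat s)=\mathbb I\{d(s,\widehat s)>\mathbf d\}$. A randomized code is a pair of conditional distributions $(Q_{X|S},Q_{\widehat S|Y})$; a deterministic code is a pair of maps $f:\mathcal S\to\mathcal X$, $g:\mathcal Y\to\widehat{\mathcal S}$. Let $\mathrm{OPT(SC)}$ be the infimum of $$\sum_{s,x,y,\widehat s}\kappa(s,x,y,\widehat s)P_S(s)Q_{X|S}(x|s)P_{Y|X}(y|x)Q_{\widehat S|Y}(\widehat s|y)$$ over all randomized codes, and let $\mathrm{OPT(DP)}$ be the supremum of $\sum_s\gamma^a(s)+\sum_y\gamma^b(y)-\sum_{s,x,y,\widehat s}\mu(s,x,y,\widehat s)$ over real-valued functions $\gamma^a,\gamma^b,\lambda^a,\lambda^b,\mu$ with $\mu\ge0$ and, for all $s,x,y,\widehat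 s$, $$\text{(D1)}\ \ \gamma^a(s)\le\sum_y\lambda^b(x,s,y)+\sum_{\widehat s,y}\mu(s,x,y,\widehat s),\qquad \text{(D2)}\ \ \gamma^b(y)\le\sum_s\lambda^a(s,\widehat s,y)+\sum_{x,s}\mu(s,x,y,\widehat s),$$ $$\text{(D3)}\ \ \lambda^a(s,\widehat s,y)+\lambda^b(x,s,y)+\mu(s,x,y,\widehat s)\le\kappa(s,x,y,\widehat s)P_S(s)P_{Y|X}(y|x).$$ **Tilted information.** Let $R_S(\delta)=\inf\{I(S;\widehat S):P_{\widehat S|S},\ \mathbb E[d(S,\widehat S)]\le\delta\}$ (natural logarithms, $\inf\emptyset=\infty$) and $\mathbf d_{\min}=\inf\{\delta:R_S(\delta)<\infty\}$. If $\mathbf d=0$, put $j_S(s,0)=\log\frac1{P_S(s)}$. If $\mathbf d>0$, assume that $\mathbf d>\mathbf d_{\min}$, that the infimum defining $R_S(\mathbf d)$ is attained by a $P_{\widehat S^*|S}$ which is unique (at the $s$ with $P_S(s)>0$), and that $R_S$ is differentiable at $\mathbf d$ with $\lambda^*=-R_S'(\mathbf d)>0$; put $$j_S(s,\mathbf d)=\log\frac1{\mathbb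 E[\exp(\lambda^*\mathbf d-\lambda^*d(s,\widehat S^*))]},$$ the expectation being over the marginal $P_{\widehat S^*}$, with $\exp(-\infty)=0$. **Auxiliary variables.** For a positive integer $T$ let $V$ be a random variable on $\{1,\dots,T\}$ given by conditional distributions $P_{V|X}$, $P_{Y|X,V}$ with $P_{Y|X}(y|x)=\sum_{t=1}^TP_{Y|X,V}(y|x,t)P_{V|X}(t|x)$, and let $P_{\bar Y|V=t}$ be distributions on $\mathcal Y$ such that $P_{\bar Y|V}(y|t)=0$ implies $P_{Y|X,V}(y|x,t)=0$ for all $x$. Put $i_{X;\bar Y|V}(x;y|t)=\log\frac{P_{Y|X,V}(y|x,t)}{P_{\bar Y|V}(y|t)}$ (with $\log 0=-\infty$). For $\gamma\in\mathbb R$ let $$M=\mathbb E\Bigl[\inf_x\Bigl\{\mathbb P[j_S(S,\mathbf d)-i_{X;\bar Y|V}(x;Y|V)\ge\gamma\mid S]+\exp(j_S(S,\mathbf d)-\gamma)\sum_{y}\sum_{t=1}^TP_{V|X}(t|x)P_{\bar Y|V}(y|t)\,\mathbb I\{i_{X;\bar Y|V}(x;y|t)>j_S(S,\mathbf d)-\gamma\}\Bigr\}\Bigr],$$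 where $\mathbb P$ is generated by $P_{V|X=x}P_{Y|X=x,V}$ and $\mathbb E$ is with respect to $P_S$, and $$B_{\rm old}=M-Te^{-\gamma},\qquad B_{\rm new}=M-T\sup_{\widehat s}\mathbb E\bigl[\exp(j_S(S,\mathbf d)-\gamma)\,\mathbb I\{d(S,\widehat s)\le\mathbf d\}\bigr].$$ **Theorem (Joint Source-Channel Coding – Further Improvement).** 1. For every code, deterministic or randomized, $$\mathbb E[\mathbb I\{d(S,\widehat S)>\mathbf d\}]\ \ge\ \mathrm{OPT(SC)}\ \ge\ \mathrm{OPT(DP)}\ \ge\ \sup_{\gamma\in\mathbb R,\,T\ge1}\ \sup_{\bar Y,V}B_{\rm new}.$$ 2. For all $\gamma,T,\bar Y,V$, the value $B_{\rm new}$ is the objective value of the following feasible point of DP: $$\lambda^b(x,s,y)=P_S(s)\sum_{t=1}^T\Bigl[P_{Y|X,V}(y|x,t)P_{V|X}(t|x)\mathbb I\{P_{Y|X,V}(y|x,t)\le P_{\bar Y|V}(y|t)e^{j_S(s,\mathbf d)-\gamma}\}+P_{\bar Y|V}(y|t)e^{j_S(s,\mathbf d)-\gamma}P_{V|X}(t|x)\mathbb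 I\{P_{Y|X,V}(y|x,t)>P_{\bar Y|V}(y|t)e^{j_S(s,\mathbf d)-\gamma}\}\Bigr],$$ $$\lambda^a(s,\widehat s,y)=-P_S(s)e^{j_S(s,\mathbf d)-\gamma}\mathbb I\{d(s,\widehat s)\le\mathbf d\}\sum_{t=1}^TP_{\bar Y|V}(y|t),$$ $\gamma^a(s)=\inf_x\sum_y\lambda^b(x,s,y)$, $\gamma^b(y)=\min_{\widehat s}\sum_s\lambda^a(s,\widehat s,y)$, $\mu\equiv0$; and this $\gamma^b$ is optimal: any $\gamma^b$ that keeps the point feasible, the other variables being unchanged, is pointwise at most this one. 3. The bound improves on the earlier one. Suppose, if $\mathbf d=0$, that for each $\widehat s$ at most one $s$ with $P_S(s)>0$ has $d(s,\widehat s)=0$ (no condition if $\mathbf d>0$). Then $B_{\rm old}\le B_{\rm new}$ for all $\gamma,T,\bar Y,V$, and hence $\sup_{\gamma,T}\sup_{\bar Y,V}B_{\rm old}\le\sup_{\gamma,T}\sup_{\bar Y,V}B_{\rm new}$. -/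

import Mathlib

open scoped ENNReal NNReal

namespace JSCC

section

variable {S X Y Sh A B : Type*}

/-- The indicator (0 or 1) of a proposition. -/
noncomputable def ind (p : Prop) : ℝ :=
  open Classical in if p then 1 else 0

/-- `K a b` is a conditional probability `K(b|a)` on a finite alphabet. -/
def IsKernel [Fintype B] (K : A → B → ℝ) : Prop :=
  ∀ a, K a ∈ stdSimplex ℝ B

/-! ### The source-channel coding problem and the dual program -/

/-- Expected loss of the randomized code with encoder `Q` and decoder `R`. -/
noncomputable def expectedLoss [Fintype S] [Fintype X] [Fintype Y] [Fintype Sh]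
    (P : S → ℝ) (W : X → Y → ℝ) (κ : S → X → Y → Sh → ℝ)
    (Q : S → X → ℝ) (R : Y → Sh → ℝ) : ℝ :=
  ∑ s, ∑ x, ∑ y, ∑ sh, κ s x y sh * (P s * Q s x * W x y * R y sh)

/-- Expected loss of the deterministic code with encoder `f` and decoder `g`. -/
noncomputable def codeLoss [Fintype S] [Fintype Y]
    (P : S → ℝ) (W : X → Y → ℝ) (κ : S → X → Y → Sh → ℝ)
    (f : S → X) (g : Y → Sh) : ℝ :=
  ∑ s, ∑ y, P s * W (f s) y * κ s (f s) y (g y)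

/-- Optimal value of problem SC (over randomized codes). -/
noncomputable def optSC [Fintype S] [Fintype X] [Fintype Y] [Fintype Sh]
    (P : S → ℝ) (W : X → Y → ℝ) (κ : S → X → Y → Sh → ℝ) : EReal :=
  ⨅ (Q : S → X → ℝ) (_ : IsKernel Q) (R : Y → Sh → ℝ) (_ : IsKernel R),
    ((expectedLoss P W κ Q R : ℝ) : EReal)

/-- The variables of the dual program DP. -/
structure DualPoint (S X Y Sh : Type*) where
  γa : S → ℝ
  γb : Y → ℝ
  lama : S → Sh → Y → ℝ
  lamb : X → S → Y → ℝ
  mu : S → X → Y → Sh → ℝ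

/-- The constraints of DP. -/
structure DualPoint.Feasible [Fintype S] [Fintype X] [Fintype Y] [Fintype Sh]
    (P : S → ℝ) (W : X → Y → ℝ) (κ : S → X → Y → Sh → ℝ)
    (p : DualPoint S X Y Sh) : Prop where
  d1 : ∀ x s, p.γa s - ∑ y, p.lamb x s y - ∑ sh, ∑ y, p.mu s x y sh ≤ 0
  d2 : ∀ sh y, p.γb y - ∑ s, p.lama s sh y - ∑ x, ∑ s, p.mu s x y sh ≤ 0
  d3 : ∀ s x y sh, p.lama s sh y + p.lamb x s y + p.mu s x y sh ≤ κ s x y sh * P s * W x y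
  mu_nonneg : ∀ s x y sh, 0 ≤ p.mu s x y sh

/-- The objective of DP. -/
noncomputable def DualPoint.objective [Fintype S] [Fintype X] [Fintype Y] [Fintype Sh]
    (p : DualPoint S X Y Sh) : ℝ :=
  ∑ s, p.γa s + ∑ y, p.γb y - ∑ s, ∑ x, ∑ y, ∑ sh, p.mu s x y sh

/-- Optimal value of the dual program DP. -/
noncomputable def optDP [Fintype S] [Fintype X] [Fintype Y] [Fintype Sh]
    (P : S → ℝ) (W : X → Y → ℝ) (κ : S → X → Y → Sh → ℝ) : EReal :=
  ⨆ (p : DualPoint S X Y Sh) (_ : p.Feasible P W κ), ((p.objective : ℝ) : EReal)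

/-- The loss `𝕀{d(s, ŝ) > D}` whose expectation is the excess distortion probability. -/
noncomputable def excessLoss (X Y : Type*) (d : S → Sh → ℝ≥0∞) (D : ℝ≥0) :
    S → X → Y → Sh → ℝ :=
  fun s _ _ sh => ind ((D : ℝ≥0∞) < d s sh)

/-! ### Rate-distortion function and tilted information (natural logarithms) -/

/-- The output distribution of the test channel `K` under the source `P`. -/
noncomputable def outputDist [Fintype S] (P : S → ℝ) (K : S → Sh → ℝ) (sh : Sh) : ℝ :=
  ∑ s, P s * K s sh

/-- `I(S; Ŝ)` in nats; summands with `P s * K s sh = 0` vanish. -/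
noncomputable def mutualInfo [Fintype S] [Fintype Sh] (P : S → ℝ) (K : S → Sh → ℝ) : ℝ :=
  ∑ s, ∑ sh, P s * K s sh * Real.log (K s sh / outputDist P K sh)

/-- `𝔼[d(S, Ŝ)] ∈ [0, ∞]`, with `0 * ∞ = 0`. -/
noncomputable def expectedDistortion [Fintype S] [Fintype Sh] (P : S → ℝ)
    (d : S → Sh → ℝ≥0∞) (K : S → Sh → ℝ) : ℝ≥0∞ :=
  ∑ s, ∑ sh, ENNReal.ofReal (P s * K s sh) * d s sh

/-- `K` is a test channel with expected distortion at most `D`. -/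
def IsTestChannel [Fintype S] [Fintype Sh] (P : S → ℝ) (d : S → Sh → ℝ≥0∞) (D : ℝ)
    (K : S → Sh → ℝ) : Prop :=
  IsKernel K ∧ (expectedDistortion P d K : EReal) ≤ (D : EReal)

/-- The rate-distortion function; it is `⊤` where there is no test channel. -/
noncomputable def rateDistortion [Fintype S] [Fintype Sh] (P : S → ℝ)
    (d : S → Sh → ℝ≥0∞) (D : ℝ) : EReal :=
  ⨅ (K : S → Sh → ℝ) (_ : IsTestChannel P d D K), ((mutualInfo P K : ℝ) : EReal)

/-- `d_min = inf {D : R(D) < ∞}`. -/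
noncomputable def dMin [Fintype S] [Fintype Sh] (P : S → ℝ) (d : S → Sh → ℝ≥0∞) : EReal :=
  ⨅ (D : ℝ) (_ : rateDistortion P d D < ⊤), (D : EReal)

/-- The test channel `K` achieves the infimum in the rate-distortion function. -/
def IsOptimalTestChannel [Fintype S] [Fintype Sh] (P : S → ℝ) (d : S → Sh → ℝ≥0∞) (D : ℝ)
    (K : S → Sh → ℝ) : Prop :=
  IsTestChannel P d D K ∧ ((mutualInfo P K : ℝ) : EReal) = rateDistortion P d D

open Classical in
/-- The optimal test channel, when there is one (otherwise an irrelevant value). -/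
noncomputable def optimalTestChannel [Fintype S] [Fintype Sh] (P : S → ℝ)
    (d : S → Sh → ℝ≥0∞) (D : ℝ) : S → Sh → ℝ :=
  if h : ∃ K, IsOptimalTestChannel P d D K then h.choose else fun _ _ => 0

/-- `λ* = -R'(D)`. -/
noncomputable def lamStar [Fintype S] [Fintype Sh] (P : S → ℝ)
    (d : S → Sh → ℝ≥0∞) (D : ℝ) : ℝ :=
  - deriv (fun r : ℝ => (rateDistortion P d r).toReal) D

/-- `exp(l * D - l * δ)` for `l > 0` and `δ ∈ [0, ∞]`, with `exp(-∞) = 0`. -/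
noncomputable def expTilt (l D : ℝ) (δ : ℝ≥0∞) : ℝ :=
  open Classical in if δ = ⊤ then 0 else Real.exp (l * D - l * δ.toReal)

/-- The tilted information `j_S(s, D)`; at `D = 0` it is the information `log (1 / P s)`. -/
noncomputable def tiltedInfo [Fintype S] [Fintype Sh] (P : S → ℝ)
    (d : S → Sh → ℝ≥0∞) (D : ℝ≥0) (s : S) : ℝ :=
  open Classical in
  if D = 0 then Real.log (1 / P s)
  else Real.log (1 / ∑ sh, outputDist P (optimalTestChannel P d D) sh *
    expTilt (lamStar P d D) D (d s sh))

/-- The standing assumptions under which the tilted information is defined at `D > d_min`.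
Uniqueness of the optimal test channel is required only at source symbols of positive
probability, as its value elsewhere is arbitrary. -/
structure TiltedRegular [Fintype S] [Fintype Sh] (P : S → ℝ)
    (d : S → Sh → ℝ≥0∞) (D : ℝ≥0) : Prop where
  dMin_lt : dMin P d < ((D : ℝ) : EReal)
  exists_optimal : ∃ K, IsOptimalTestChannel P d D K
  unique_optimal : ∀ K K', IsOptimalTestChannel P d D K → IsOptimalTestChannel P d D K' →
    ∀ s, P s ≠ 0 → K s = K' s
  differentiable : DifferentiableAt ℝ (fun r : ℝ => (rateDistortion P d r).toReal) D
  lamStar_pos : 0 < lamStar P d D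

/-! ### The auxiliary variables and the two converse bounds -/

/-- A random variable `V` with values in a set of size `T`, jointly distributed with the
channel `W` (so `∑ t, P(y|x,t) P(t|x) = W(y|x)`), and a distribution `PYbar t` on the output
alphabet for each `t`, dominating each `P(·|x,t)`. -/
structure Auxiliary [Fintype Y] (W : X → Y → ℝ) (T : ℕ) where
  PV : X → Fin T → ℝ
  PYV : X → Fin T → Y → ℝ
  PYbar : Fin T → Y → ℝ
  PV_kernel : IsKernel PV
  PYV_kernel : ∀ x, IsKernel (PYV x)
  PYbar_kernel : IsKernel PYbar
  channel_eq : ∀ x y, W x y = ∑ t, PYV x t y * PV x t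
  dominated : ∀ x t y, PYbar t y = 0 → PYV x t y = 0

/-- The information density `log (P(y|x,t) / Pbar(y|t))`, with `log 0 = -∞`. -/
noncomputable def infoDensity [Fintype Y] {W : X → Y → ℝ} {T : ℕ} (A : Auxiliary W T)
    (x : X) (y : Y) (t : Fin T) : EReal :=
  ENNReal.log (ENNReal.ofReal (A.PYV x t y) / ENNReal.ofReal (A.PYbar t y))

/-- `ℙ[j - i(x; Y | V) ≥ γ]` with `(V, Y)` distributed as `P(t|x) P(y|x,t)`. -/
noncomputable def probTerm [Fintype Y] {W : X → Y → ℝ} {T : ℕ} (A : Auxiliary W T)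
    (j γ : ℝ) (x : X) : ℝ :=
  ∑ y, ∑ t, A.PV x t * A.PYV x t y * ind ((γ : EReal) ≤ (j : EReal) - infoDensity A x y t)

/-- `exp(j - γ) ∑_y ∑_t P(t|x) Pbar(y|t) 𝕀{i(x; y | t) > j - γ}`. -/
noncomputable def extraTerm [Fintype Y] {W : X → Y → ℝ} {T : ℕ} (A : Auxiliary W T)
    (j γ : ℝ) (x : X) : ℝ :=
  Real.exp (j - γ) *
    ∑ y, ∑ t, A.PV x t * A.PYbar t y * ind (((j - γ : ℝ) : EReal) < infoDensity A x y t)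

/-- The expectation over the source that is common to both bounds. -/
noncomputable def mainTerm [Fintype S] [Fintype Y] [Fintype Sh] (P : S → ℝ)
    (d : S → Sh → ℝ≥0∞) (D : ℝ≥0) (γ : ℝ) {W : X → Y → ℝ} {T : ℕ} (A : Auxiliary W T) : ℝ :=
  ∑ s, P s * ⨅ x, (probTerm A (tiltedInfo P d D s) γ x + extraTerm A (tiltedInfo P d D s) γ x)

/-- `𝔼[exp(j_S(S, D) - γ) 𝕀{d(S, ŝ) ≤ D}]`. -/
noncomputable def coverTerm [Fintype S] [Fintype Sh] (P : S → ℝ)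
    (d : S → Sh → ℝ≥0∞) (D : ℝ≥0) (γ : ℝ) (sh : Sh) : ℝ :=
  ∑ s, P s * (Real.exp (tiltedInfo P d D s - γ) * ind (d s sh ≤ (D : ℝ≥0∞)))

/-- The earlier bound at given parameters. -/
noncomputable def oldValue [Fintype S] [Fintype Y] [Fintype Sh] (P : S → ℝ)
    (d : S → Sh → ℝ≥0∞) (D : ℝ≥0) (γ : ℝ) {W : X → Y → ℝ} {T : ℕ} (A : Auxiliary W T) : ℝ :=
  mainTerm P d D γ A - T * Real.exp (-γ)

/-- The improved bound at given parameters. -/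
noncomputable def newValue [Fintype S] [Fintype Y] [Fintype Sh] (P : S → ℝ)
    (d : S → Sh → ℝ≥0∞) (D : ℝ≥0) (γ : ℝ) {W : X → Y → ℝ} {T : ℕ} (A : Auxiliary W T) : ℝ :=
  mainTerm P d D γ A - T * ⨆ sh, coverTerm P d D γ sh

/-- The earlier converse: supremum over `γ`, `T` and the auxiliary variables. -/
noncomputable def oldBound [Fintype S] [Fintype Y] [Fintype Sh] (P : S → ℝ)
    (W : X → Y → ℝ) (d : S → Sh → ℝ≥0∞) (D : ℝ≥0) : EReal :=
  ⨆ (γ : ℝ) (T : ℕ) (_ : 0 < T) (A : Auxiliary W T), ((oldValue P d D γ A : ℝ) : EReal)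

/-- The improved converse: supremum over `γ`, `T` and the auxiliary variables. -/
noncomputable def newBound [Fintype S] [Fintype Y] [Fintype Sh] (P : S → ℝ)
    (W : X → Y → ℝ) (d : S → Sh → ℝ≥0∞) (D : ℝ≥0) : EReal :=
  ⨆ (γ : ℝ) (T : ℕ) (_ : 0 < T) (A : Auxiliary W T), ((newValue P d D γ A : ℝ) : EReal)

/-! ### The dual variables -/

noncomputable def dualLamb [Fintype S] [Fintype Y] [Fintype Sh] (P : S → ℝ)
    (d : S → Sh → ℝ≥0∞) (D : ℝ≥0) (γ : ℝ) {W : X → Y → ℝ} {T : ℕ} (A : Auxiliary W T)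
    (x : X) (s : S) (y : Y) : ℝ :=
  P s * ∑ t,
    (A.PYV x t y * A.PV x t *
        ind (A.PYV x t y ≤ A.PYbar t y * Real.exp (tiltedInfo P d D s - γ)) +
      A.PYbar t y * Real.exp (tiltedInfo P d D s - γ) * A.PV x t *
        ind (A.PYbar t y * Real.exp (tiltedInfo P d D s - γ) < A.PYV x t y))

noncomputable def dualLama [Fintype S] [Fintype Y] [Fintype Sh] (P : S → ℝ)
    (d : S → Sh → ℝ≥0∞) (D : ℝ≥0) (γ : ℝ) {W : X → Y → ℝ} {T : ℕ} (A : Auxiliary W T)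
    (s : S) (sh : Sh) (y : Y) : ℝ :=
  -(P s * Real.exp (tiltedInfo P d D s - γ) * ind (d s sh ≤ (D : ℝ≥0∞)) * ∑ t, A.PYbar t y)

/-- The dual point with `γa s = inf_x ∑_y λb`, `γb y = min_ŝ ∑_s λa` and `μ = 0`. -/
noncomputable def dualPoint [Fintype S] [Fintype Y] [Fintype Sh] (P : S → ℝ)
    (d : S → Sh → ℝ≥0∞) (D : ℝ≥0) (γ : ℝ) {W : X → Y → ℝ} {T : ℕ} (A : Auxiliary W T) :
    DualPoint S X Y Sh where
  γa s := ⨅ x, ∑ y, dualLamb P d D γ A x s y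
  γb y := ⨅ sh, ∑ s, dualLama P d D γ A s sh y
  lama := dualLama P d D γ A
  lamb := dualLamb P d D γ A
  mu := fun _ _ _ _ => 0

end

end JSCC

open JSCC

/-!
Weak duality compares a dual point with a pair of kernels `Q`, `R` constraint by constraint; the
multiplier `μ` enters with the weight `Q + R - 1`, and drops out because `Q + R - 1 ≤ Q R` on
`[0, 1]`. The dual point of the theorem has `λᵇ(x,s,y) = P(s) W'(y|x)`, where `W'` is the channel
with `P(y|x,t)` replaced by `min (P(y|x,t)) (P_Ȳ(y|t) e^(j(s) - γ))`. Since `W'` lies below `W`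
and below the amount that `λᵃ` subtracts when `d(s, ŝ) ≤ D`, the point is feasible.

The comparison of the two bounds comes down to `𝔼[e^(j(S)) 𝕀{d(S, ŝ) ≤ D}] ≤ 1`. For `D > 0` put
`λ = λ*` and let `Z_q(s) = ∑ ŝ, q(ŝ) e^(λ D - λ d(s, ŝ))`. Convexity of the mutual information
makes the optimal test channel a minimizer of the Lagrangian `I(S; Ŝ) + λ 𝔼[d(S, Ŝ)]`. By the
Gibbs variational principle the least value of the Lagrangian, up to `λ D`, is
`-max_q 𝔼[log Z_q(S)]`, so the output law `q*` of that channel is a maximizer. Moving from `q*`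
towards the point mass at `ŝ` cannot increase `𝔼[log Z_q(S)]`, and the derivative at `q*` says
`𝔼[e^(λ D - λ d(S, ŝ)) / Z_{q*}(S)] ≤ 1`. Here `1 / Z_{q*}(s) = e^(j(s))`, and the other factor
dominates `𝕀{d(s, ŝ) ≤ D}`.
-/

namespace JSCC

open Finset

section Kernel

variable {A B : Type*} [Fintype B]

theorem IsKernel.nonneg {K : A → B → ℝ} (hK : IsKernel K) : 0 ≤ K :=
  fun a => (hK a).1

theorem IsKernel.sum_eq_one {K : A → B → ℝ} (hK : IsKernel K) (a : A) : ∑ b, K a b = 1 :=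
  (hK a).2

theorem IsKernel.le_one {K : A → B → ℝ} (hK : IsKernel K) (a : A) (b : B) : K a b ≤ 1 :=
  (mem_Icc_of_mem_stdSimplex (hK a) b).2

theorem isKernel_single [DecidableEq B] (f : A → B) : IsKernel fun a => Pi.single (f a) (1 : ℝ) :=
  fun a => single_mem_stdSimplex ℝ (f a)

theorem convex_setOf_isKernel : Convex ℝ {K : A → B → ℝ | IsKernel K} :=
  fun _ hK _ hK' _ _ ha hb hab a => convex_stdSimplex ℝ B (hK a) (hK' a) ha hb hab

theorem le_sum_mul_of_mem_stdSimplex {p f : B → ℝ} {c : ℝ} (hp : p ∈ stdSimplex ℝ B)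
    (hf : ∀ b, c ≤ f b) : c ≤ ∑ b, p b * f b :=
  calc c = ∑ b, p b * c := by rw [← sum_mul, hp.2, one_mul]
    _ ≤ ∑ b, p b * f b := sum_le_sum fun b _ => mul_le_mul_of_nonneg_left (hf b) (hp.1 b)

end Kernel

section WeakDuality

variable {S X Y Sh : Type*} [Fintype S] [Fintype X] [Fintype Y] [Fintype Sh]
  {P : S → ℝ} {W : X → Y → ℝ} {κ : S → X → Y → Sh → ℝ} {p : DualPoint S X Y Sh}
  {Q : S → X → ℝ} {R : Y → Sh → ℝ}

theorem DualPoint.Feasible.sum_γa_le (hp : p.Feasible P W κ) (hQ : IsKernel Q)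
    (hR : IsKernel R) :
    ∑ s, p.γa s ≤
      ∑ s, ∑ x, ∑ y, ∑ sh, Q s x * (R y sh * p.lamb x s y + p.mu s x y sh) := by
  refine sum_le_sum fun s _ => ?_
  have hγa (x : X) : p.γa s ≤ ∑ y, p.lamb x s y + ∑ y, ∑ sh, p.mu s x y sh := by
    rw [sum_comm (f := fun y sh => p.mu s x y sh)]
    linarith [hp.d1 x s]
  refine (le_sum_mul_of_mem_stdSimplex (hQ s) hγa).trans_eq ?_
  simp only [← mul_sum, sum_add_distrib, ← sum_mul, hR.sum_eq_one, one_mul]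

theorem DualPoint.Feasible.sum_γb_le (hp : p.Feasible P W κ) (hQ : IsKernel Q)
    (hR : IsKernel R) :
    ∑ y, p.γb y ≤
      ∑ s, ∑ x, ∑ y, ∑ sh, R y sh * (Q s x * p.lama s sh y + p.mu s x y sh) := by
  have hγb (y : Y) (sh : Sh) : p.γb y ≤ ∑ s, p.lama s sh y + ∑ s, ∑ x, p.mu s x y sh := by
    rw [sum_comm (f := fun s x => p.mu s x y sh)]
    linarith [hp.d2 sh y]
  calc ∑ y, p.γb y
      ≤ ∑ y, ∑ sh, R y sh * (∑ s, p.lama s sh y + ∑ s, ∑ x, p.mu s x y sh) :=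
        sum_le_sum fun y _ => le_sum_mul_of_mem_stdSimplex (hR y) (hγb y)
    _ = ∑ y, ∑ sh, ∑ s, ∑ x, R y sh * (Q s x * p.lama s sh y + p.mu s x y sh) := by
        simp only [← mul_sum, sum_add_distrib, ← sum_mul, hQ.sum_eq_one, one_mul]
    _ = ∑ s, ∑ x, ∑ y, ∑ sh, R y sh * (Q s x * p.lama s sh y + p.mu s x y sh) := by
        simpa only [Fintype.sum_prod_type] using sum_comm (s := (univ : Finset (Y × Sh)))
          (t := (univ : Finset (S × X))) (f := fun i j =>
            R i.1 i.2 * (Q j.1 j.2 * p.lama j.1 i.2 i.1 + p.mu j.1 j.2 i.1 i.2))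

theorem DualPoint.Feasible.add_sub_mu_le (hp : p.Feasible P W κ) (hQ : IsKernel Q)
    (hR : IsKernel R) (s : S) (x : X) (y : Y) (sh : Sh) :
    Q s x * (R y sh * p.lamb x s y + p.mu s x y sh) +
        R y sh * (Q s x * p.lama s sh y + p.mu s x y sh) - p.mu s x y sh ≤
      κ s x y sh * (P s * Q s x * W x y * R y sh) := by
  have hd3 := mul_le_mul_of_nonneg_left (hp.d3 s x y sh)
    (mul_nonneg (hQ.nonneg s x) (hR.nonneg y sh))
  -- `Q + R - 1 ≤ Q R`, which absorbs the two extra copies of `μ`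
  have hmu := mul_nonneg (mul_nonneg (sub_nonneg.2 (hQ.le_one s x))
    (sub_nonneg.2 (hR.le_one y sh))) (hp.mu_nonneg s x y sh)
  linarith

theorem DualPoint.Feasible.objective_le_expectedLoss (hp : p.Feasible P W κ) (hQ : IsKernel Q)
    (hR : IsKernel R) : p.objective ≤ expectedLoss P W κ Q R := by
  have hsum : ∑ s, ∑ x, ∑ y, ∑ sh, (Q s x * (R y sh * p.lamb x s y + p.mu s x y sh) +
        R y sh * (Q s x * p.lama s sh y + p.mu s x y sh) - p.mu s x y sh) ≤
      expectedLoss P W κ Q R :=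
    sum_le_sum fun s _ => sum_le_sum fun x _ => sum_le_sum fun y _ => sum_le_sum fun sh _ =>
      hp.add_sub_mu_le hQ hR s x y sh
  simp only [sum_sub_distrib, sum_add_distrib] at hsum
  have ha := hp.sum_γa_le hQ hR
  have hb := hp.sum_γb_le hQ hR
  unfold DualPoint.objective
  linarith

variable (P W κ)

theorem optDP_le_optSC : optDP P W κ ≤ optSC P W κ :=
  iSup₂_le fun _ hp => le_iInf₂ fun _ hQ => le_iInf₂ fun _ hR =>
    EReal.coe_le_coe_iff.2 (hp.objective_le_expectedLoss hQ hR)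

theorem optSC_le_expectedLoss (hQ : IsKernel Q) (hR : IsKernel R) :
    optSC P W κ ≤ (expectedLoss P W κ Q R : EReal) :=
  (iInf₂_le Q hQ).trans (iInf₂_le R hR)

theorem expectedLoss_single [DecidableEq X] [DecidableEq Sh] (f : S → X) (g : Y → Sh) :
    expectedLoss P W κ (fun s => Pi.single (f s) 1) (fun y => Pi.single (g y) 1) =
      codeLoss P W κ f g := by
  simp [expectedLoss, codeLoss, Pi.single_apply, mul_comm]

theorem optSC_le_codeLoss (f : S → X) (g : Y → Sh) :
    optSC P W κ ≤ (codeLoss P W κ f g : EReal) := by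
  classical
  rw [← expectedLoss_single]
  exact optSC_le_expectedLoss P W κ (isKernel_single f) (isKernel_single g)

end WeakDuality

section Indicator

theorem ind_of_true {p : Prop} (h : p) : ind p = 1 :=
  if_pos h

theorem ind_of_false {p : Prop} (h : ¬p) : ind p = 0 :=
  if_neg h

theorem mul_ind_le_add_mul_ind_lt (a b : ℝ) : a * ind (a ≤ b) + b * ind (b < a) = min a b := by
  rcases le_or_gt a b with h | h
  · rw [ind_of_true h, ind_of_false h.not_gt, min_eq_left h, mul_one, mul_zero, add_zero]
  · rw [ind_of_false h.not_ge, ind_of_true h, min_eq_right h.le, mul_zero, mul_one, zero_add]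

end Indicator

section DualPoint

variable {S X Y Sh : Type*} [Fintype Y] {W : X → Y → ℝ} {T : ℕ}

/-- The channel `W`, with each component `P(y|x,t)` clipped at the multiple `exp c` of the
reference law `P_Ȳ(y|t)`. The dual variable `λᵇ(x,s,y)` is `P s` times its value at
`c = j_S(s, D) - γ`, see `dualLamb_eq`. -/
noncomputable def clippedChannel (A : Auxiliary W T) (c : ℝ) (x : X) (y : Y) : ℝ :=
  ∑ t, A.PV x t * min (A.PYV x t y) (A.PYbar t y * Real.exp c)

theorem clippedChannel_le_channel (A : Auxiliary W T) (c : ℝ) (x : X) (y : Y) :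
    clippedChannel A c x y ≤ W x y := by
  rw [A.channel_eq]
  refine sum_le_sum fun t _ => ?_
  rw [mul_comm]
  exact mul_le_mul_of_nonneg_right (min_le_left _ _) (A.PV_kernel.nonneg x t)

theorem clippedChannel_le_exp_mul_sum (A : Auxiliary W T) (c : ℝ) (x : X) (y : Y) :
    clippedChannel A c x y ≤ Real.exp c * ∑ t, A.PYbar t y := by
  rw [mul_comm, sum_mul]
  refine sum_le_sum fun t _ => ?_
  have hclip : 0 ≤ A.PYbar t y * Real.exp c :=
    mul_nonneg (A.PYbar_kernel.nonneg t y) (Real.exp_pos c).le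
  calc A.PV x t * min (A.PYV x t y) (A.PYbar t y * Real.exp c)
      ≤ A.PV x t * (A.PYbar t y * Real.exp c) :=
        mul_le_mul_of_nonneg_left (min_le_right _ _) (A.PV_kernel.nonneg x t)
    _ ≤ A.PYbar t y * Real.exp c := mul_le_of_le_one_left hclip (A.PV_kernel.le_one x t)

theorem infoDensity_le_iff (A : Auxiliary W T) {x : X} {y : Y} {t : Fin T}
    (h : A.PYbar t y ≠ 0) (c : ℝ) :
    infoDensity A x y t ≤ (c : EReal) ↔ A.PYV x t y ≤ A.PYbar t y * Real.exp c := by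
  have hPYbar : 0 < A.PYbar t y := (A.PYbar_kernel.nonneg t y).lt_of_ne' h
  have hc : (c : EReal) = ENNReal.log (ENNReal.ofReal (Real.exp c)) := by
    rw [ENNReal.log_ofReal_of_pos (Real.exp_pos c), Real.log_exp]
  rw [infoDensity, hc, ENNReal.log_le_log_iff, ← ENNReal.ofReal_div_of_pos hPYbar,
    ENNReal.ofReal_le_ofReal_iff (Real.exp_pos c).le, div_le_iff₀ hPYbar, mul_comm]

theorem coe_le_coe_sub_iff (γ j : ℝ) (i : EReal) :
    (γ : EReal) ≤ (j : EReal) - i ↔ i ≤ ((j - γ : ℝ) : EReal) := by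
  induction i with
  | bot => simp
  | top => simpa using EReal.coe_ne_top (j - γ)
  | coe i => norm_cast; exact le_sub_comm

theorem probTerm_add_extraTerm (A : Auxiliary W T) (j γ : ℝ) (x : X) :
    probTerm A j γ x + extraTerm A j γ x = ∑ y, clippedChannel A (j - γ) x y := by
  simp only [probTerm, extraTerm, clippedChannel, mul_sum, ← sum_add_distrib]
  refine sum_congr rfl fun y _ => sum_congr rfl fun t _ => ?_
  rw [← mul_ind_le_add_mul_ind_lt]
  by_cases h : A.PYbar t y = 0
  · simp [h, A.dominated x t y h]
  · rw [coe_le_coe_sub_iff, ← not_le (a := infoDensity A x y t), infoDensity_le_iff A h, not_le]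
    ring

variable [Fintype S] [Fintype Sh]

theorem dualLamb_eq (P : S → ℝ) (d : S → Sh → ℝ≥0∞) (D : ℝ≥0) (γ : ℝ) (A : Auxiliary W T)
    (x : X) (s : S) (y : Y) :
    dualLamb P d D γ A x s y = P s * clippedChannel A (tiltedInfo P d D s - γ) x y := by
  rw [dualLamb, clippedChannel]
  refine congrArg (P s * ·) (sum_congr rfl fun t _ => ?_)
  rw [← mul_ind_le_add_mul_ind_lt]
  ring

theorem sum_dualLamb (P : S → ℝ) (d : S → Sh → ℝ≥0∞) (D : ℝ≥0) (γ : ℝ) (A : Auxiliary W T)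
    (x : X) (s : S) :
    ∑ y, dualLamb P d D γ A x s y =
      P s * (probTerm A (tiltedInfo P d D s) γ x + extraTerm A (tiltedInfo P d D s) γ x) := by
  simp only [dualLamb_eq, probTerm_add_extraTerm, mul_sum]

theorem sum_dualLama (P : S → ℝ) (d : S → Sh → ℝ≥0∞) (D : ℝ≥0) (γ : ℝ) (A : Auxiliary W T)
    (sh : Sh) (y : Y) :
    ∑ s, dualLama P d D γ A s sh y = (-∑ t, A.PYbar t y) * coverTerm P d D γ sh := by
  simp only [dualLama, coverTerm]
  rw [mul_sum]
  exact sum_congr rfl fun s _ => by ring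

theorem dualLama_add_dualLamb_le {P : S → ℝ} (hP : 0 ≤ P) (d : S → Sh → ℝ≥0∞) (D : ℝ≥0) (γ : ℝ)
    (A : Auxiliary W T) (s : S) (x : X) (y : Y) (sh : Sh) :
    dualLama P d D γ A s sh y + dualLamb P d D γ A x s y ≤
      excessLoss X Y d D s x y sh * P s * W x y := by
  rw [dualLamb_eq, dualLama, excessLoss]
  set c := tiltedInfo P d D s - γ
  rcases le_or_gt (d s sh) D with h | h
  · rw [ind_of_true h, ind_of_false h.not_gt]
    linarith [mul_le_mul_of_nonneg_left (clippedChannel_le_exp_mul_sum A c x y) (hP s)]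
  · rw [ind_of_false h.not_ge, ind_of_true h]
    linarith [mul_le_mul_of_nonneg_left (clippedChannel_le_channel A c x y) (hP s)]

theorem sum_iInf_sum_dualLamb {P : S → ℝ} (hP : 0 ≤ P) (d : S → Sh → ℝ≥0∞) (D : ℝ≥0) (γ : ℝ)
    (A : Auxiliary W T) :
    ∑ s, ⨅ x, ∑ y, dualLamb P d D γ A x s y = mainTerm P d D γ A := by
  refine sum_congr rfl fun s _ => ?_
  simp only [sum_dualLamb]
  exact (Real.mul_iInf_of_nonneg (hP s) _).symm

theorem sum_iInf_sum_dualLama (P : S → ℝ) (d : S → Sh → ℝ≥0∞) (D : ℝ≥0) (γ : ℝ)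
    (A : Auxiliary W T) :
    ∑ y, ⨅ sh, ∑ s, dualLama P d D γ A s sh y = -(T * ⨆ sh, coverTerm P d D γ sh) := by
  have hiInf (y : Y) : ⨅ sh, ∑ s, dualLama P d D γ A s sh y =
      (-∑ t, A.PYbar t y) * ⨆ sh, coverTerm P d D γ sh := by
    simp only [sum_dualLama]
    exact (Real.mul_iSup_of_nonpos
      (neg_nonpos.2 (sum_nonneg fun t _ => A.PYbar_kernel.nonneg t y)) _).symm
  have hmass : ∑ y, ∑ t, A.PYbar t y = T := by
    rw [sum_comm]
    simp [A.PYbar_kernel.sum_eq_one]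
  simp only [hiInf]
  rw [← sum_mul, sum_neg_distrib, hmass, neg_mul]

variable [Fintype X]

theorem dualPoint_feasible {P : S → ℝ} (hP : 0 ≤ P) (d : S → Sh → ℝ≥0∞) (D : ℝ≥0) (γ : ℝ)
    (A : Auxiliary W T) : (dualPoint P d D γ A).Feasible P W (excessLoss X Y d D) where
  d1 x s := by
    simpa [dualPoint] using
      ciInf_le (Finite.bddBelow_range fun x => ∑ y, dualLamb P d D γ A x s y) x
  d2 sh y := by
    simpa [dualPoint] using
      ciInf_le (Finite.bddBelow_range fun sh => ∑ s, dualLama P d D γ A s sh y) sh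
  d3 s x y sh := by
    simpa [dualPoint] using dualLama_add_dualLamb_le hP d D γ A s x y sh
  mu_nonneg _ _ _ _ := le_rfl

theorem dualPoint_objective {P : S → ℝ} (hP : 0 ≤ P) (d : S → Sh → ℝ≥0∞) (D : ℝ≥0) (γ : ℝ)
    (A : Auxiliary W T) : (dualPoint P d D γ A).objective = newValue P d D γ A := by
  simp only [DualPoint.objective, dualPoint, newValue, sum_iInf_sum_dualLamb hP,
    sum_iInf_sum_dualLama, sum_const_zero, sub_zero, ← sub_eq_add_neg]

theorem le_dualPoint_γb [Nonempty Sh] {P : S → ℝ} {κ : S → X → Y → Sh → ℝ}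
    {d : S → Sh → ℝ≥0∞} {D : ℝ≥0} {γ : ℝ} {A : Auxiliary W T} {γb : Y → ℝ}
    (h : DualPoint.Feasible P W κ { dualPoint P d D γ A with γb := γb }) (y : Y) :
    γb y ≤ (dualPoint P d D γ A).γb y :=
  le_ciInf fun sh => by simpa [dualPoint] using h.d2 sh y

theorem newBound_le_optDP {P : S → ℝ} (hP : 0 ≤ P) (W : X → Y → ℝ) (d : S → Sh → ℝ≥0∞) (D : ℝ≥0) :
    newBound P W d D ≤ optDP P W (excessLoss X Y d D) := by
  refine iSup₂_le fun γ T => iSup₂_le fun _ A => ?_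
  rw [← dualPoint_objective hP]
  exact le_iSup₂_of_le _ (dualPoint_feasible hP d D γ A) le_rfl

end DualPoint

section RelEntropy

variable {ι : Type*} [Fintype ι]

/-- The relative entropy `∑ i, a i log (a i / b i)` of nonnegative weights, in nats. It is meant
for `a` that vanishes where `b` does, since the summands with `b i = 0` are `0` here. -/
noncomputable def relEntropy (a b : ι → ℝ) : ℝ :=
  ∑ i, a i * Real.log (a i / b i)

theorem sub_le_mul_log_div {a b : ℝ} (ha : 0 ≤ a) (hb : 0 ≤ b) (hab : b = 0 → a = 0) :
    a - b ≤ a * Real.log (a / b) := by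
  rcases ha.eq_or_lt with rfl | ha
  · simpa using hb
  have hb : 0 < b := hb.lt_of_ne' (mt hab ha.ne')
  calc a - b = a * (1 - (a / b)⁻¹) := by field_simp
    _ ≤ a * Real.log (a / b) :=
      mul_le_mul_of_nonneg_left (Real.one_sub_inv_le_log_of_pos (div_pos ha hb)) ha.le

theorem sum_mul_log_sum_div_sum_le_relEntropy {a b : ι → ℝ} (ha : 0 ≤ a) (hb : 0 ≤ b)
    (hab : ∀ i, b i = 0 → a i = 0) :
    (∑ i, a i) * Real.log ((∑ i, a i) / ∑ i, b i) ≤ relEntropy a b := by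
  rcases (sum_nonneg fun i _ => ha i).eq_or_lt with hA | hA
  · have ha0 (i : ι) : a i = 0 :=
      (sum_eq_zero_iff_of_nonneg fun i _ => ha i).1 hA.symm i (mem_univ i)
    simp [relEntropy, ha0]
  have hB : 0 < ∑ i, b i := by
    refine (sum_nonneg fun i _ => hb i).lt_of_ne' fun hB => hA.ne' (sum_eq_zero fun i hi => ?_)
    exact hab i ((sum_eq_zero_iff_of_nonneg fun i _ => hb i).1 hB i hi)
  set c := (∑ i, a i) / ∑ i, b i with hc_def
  have hc : 0 < c := div_pos hA hB
  have hterm (i : ι) : a i * Real.log c + (a i - b i * c) ≤ a i * Real.log (a i / b i) := by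
    have htangent := sub_le_mul_log_div (ha i) (mul_nonneg (hb i) hc.le)
      fun h => hab i ((mul_eq_zero.1 h).resolve_right hc.ne')
    rcases eq_or_ne (a i) 0 with hai | hai
    · simpa [hai] using mul_nonneg (hb i) hc.le
    rw [← div_div, Real.log_div (div_ne_zero hai (mt (hab i) hai)) hc.ne'] at htangent
    linarith
  calc (∑ i, a i) * Real.log c = ∑ i, (a i * Real.log c + (a i - b i * c)) := by
        rw [sum_add_distrib, sum_sub_distrib, ← sum_mul, ← sum_mul, hc_def,
          mul_div_cancel₀ _ hB.ne', sub_self, add_zero]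
    _ ≤ relEntropy a b := sum_le_sum fun i _ => hterm i

theorem mul_log_div_convex {a a' b b' s t : ℝ} (ha : 0 ≤ a) (ha' : 0 ≤ a') (hb : 0 ≤ b)
    (hb' : 0 ≤ b') (hab : b = 0 → a = 0) (hab' : b' = 0 → a' = 0) (hs : 0 ≤ s) (ht : 0 ≤ t) :
    (s * a + t * a') * Real.log ((s * a + t * a') / (s * b + t * b')) ≤
      s * (a * Real.log (a / b)) + t * (a' * Real.log (a' / b')) := by
  have hscale (r u v : ℝ) : r * u * Real.log (r * u / (r * v)) = r * (u * Real.log (u / v)) := by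
    rcases eq_or_ne r 0 with rfl | hr
    · simp
    · rw [mul_div_mul_left u v hr, mul_assoc]
  have hlogsum := sum_mul_log_sum_div_sum_le_relEntropy (a := ![s * a, t * a'])
    (b := ![s * b, t * b'])
    (Fin.forall_fin_two.2 ⟨mul_nonneg hs ha, mul_nonneg ht ha'⟩)
    (Fin.forall_fin_two.2 ⟨mul_nonneg hs hb, mul_nonneg ht hb'⟩)
    (Fin.forall_fin_two.2 ⟨fun h => mul_eq_zero.2 ((mul_eq_zero.1 h).imp_right hab),
      fun h => mul_eq_zero.2 ((mul_eq_zero.1 h).imp_right hab')⟩)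
  simpa only [relEntropy, Fin.sum_univ_two, Matrix.cons_val_zero, Matrix.cons_val_one,
    hscale] using hlogsum

theorem relEntropy_convex {a a' b b' : ι → ℝ} {s t : ℝ} (ha : 0 ≤ a) (ha' : 0 ≤ a') (hb : 0 ≤ b)
    (hb' : 0 ≤ b') (hab : ∀ i, b i = 0 → a i = 0) (hab' : ∀ i, b' i = 0 → a' i = 0) (hs : 0 ≤ s)
    (ht : 0 ≤ t) :
    relEntropy (s • a + t • a') (s • b + t • b') ≤
      s * relEntropy a b + t * relEntropy a' b' := by
  simp only [relEntropy, mul_sum, ← sum_add_distrib]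
  exact sum_le_sum fun i _ =>
    mul_log_div_convex (ha i) (ha' i) (hb i) (hb' i) (hab i) (hab' i) hs ht

theorem relEntropy_nonneg {a b : ι → ℝ} (ha : a ∈ stdSimplex ℝ ι) (hb : b ∈ stdSimplex ℝ ι)
    (hab : ∀ i, b i = 0 → a i = 0) : 0 ≤ relEntropy a b := by
  simpa [ha.2, hb.2] using sum_mul_log_sum_div_sum_le_relEntropy ha.1 hb.1 hab

theorem relEntropy_smul_self {w : ι → ℝ} {c : ℝ} (hc : c * ∑ i, w i = 1) :
    relEntropy (c • w) w = Real.log c := by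
  calc relEntropy (c • w) w = ∑ i, c * w i * Real.log c := by
        refine sum_congr rfl fun i _ => ?_
        rcases eq_or_ne (w i) 0 with hw | hw
        · simp [hw]
        · rw [Pi.smul_apply, smul_eq_mul, mul_div_cancel_right₀ c hw]
    _ = Real.log c := by rw [← sum_mul, ← mul_sum, hc, one_mul]

end RelEntropy

section OutputDist

variable {S Sh : Type*} [Fintype S]

theorem outputDist_smul_add_smul (P : S → ℝ) (K K' : S → Sh → ℝ) (a b : ℝ) :
    outputDist P (a • K + b • K') = a • outputDist P K + b • outputDist P K' := by
  ext sh
  simp only [outputDist, Pi.add_apply, Pi.smul_apply, smul_eq_mul, mul_sum, ← sum_add_distrib]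
  exact sum_congr rfl fun s _ => by ring

variable {P : S → ℝ} {K : S → Sh → ℝ}

theorem outputDist_nonneg (hP : 0 ≤ P) (hK : 0 ≤ K) : 0 ≤ outputDist P K :=
  fun sh => sum_nonneg fun s _ => mul_nonneg (hP s) (hK s sh)

theorem outputDist_mem_stdSimplex [Fintype Sh] (hP : P ∈ stdSimplex ℝ S) (hK : IsKernel K) :
    outputDist P K ∈ stdSimplex ℝ Sh := by
  refine ⟨outputDist_nonneg hP.1 hK.nonneg, ?_⟩
  simp only [outputDist]
  rw [sum_comm]
  simp only [← mul_sum, hK.sum_eq_one, mul_one, hP.2]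

theorem eq_zero_of_outputDist_eq_zero (hP : 0 ≤ P) (hK : 0 ≤ K) {s : S} (hs : P s ≠ 0) {sh : Sh}
    (h : outputDist P K sh = 0) : K s sh = 0 :=
  (mul_eq_zero.1 ((sum_eq_zero_iff_of_nonneg fun s _ => mul_nonneg (hP s) (hK s sh)).1 h s
    (mem_univ s))).resolve_left hs

end OutputDist

section MutualInfo

variable {S Sh : Type*} [Fintype Sh]

/-- The Gibbs channel of the weights `w`, obtained by normalizing each `w s`. It minimizes
`condDivergence P · w`. At `s` where `w s` has no mass it is given by a fixed law `q`. -/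
noncomputable def gibbsKernel (q : Sh → ℝ) (w : S → Sh → ℝ) (s : S) : Sh → ℝ :=
  open Classical in if ∑ sh, w s sh = 0 then q else (∑ sh, w s sh)⁻¹ • w s

theorem gibbsKernel_of_sum_ne_zero (q : Sh → ℝ) {w : S → Sh → ℝ} {s : S}
    (h : ∑ sh, w s sh ≠ 0) : gibbsKernel q w s = (∑ sh, w s sh)⁻¹ • w s :=
  if_neg h

theorem isKernel_gibbsKernel {q : Sh → ℝ} (hq : q ∈ stdSimplex ℝ Sh) {w : S → Sh → ℝ}
    (hw : 0 ≤ w) : IsKernel (gibbsKernel q w) := by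
  intro s
  by_cases h : ∑ sh, w s sh = 0
  · rwa [gibbsKernel, if_pos h]
  rw [gibbsKernel_of_sum_ne_zero q h]
  refine ⟨fun sh => mul_nonneg (inv_nonneg.2 (sum_nonneg fun sh _ => hw s sh)) (hw s sh), ?_⟩
  simp only [Pi.smul_apply, smul_eq_mul]
  rw [← mul_sum, inv_mul_cancel₀ h]

variable [Fintype S]

/-- The conditional relative entropy `D(K ‖ w | P)`, where the weights `w s` need not be
normalized. -/
noncomputable def condDivergence (P : S → ℝ) (K w : S → Sh → ℝ) : ℝ :=
  ∑ s, P s * relEntropy (K s) (w s)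

theorem mutualInfo_eq_condDivergence (P : S → ℝ) (K : S → Sh → ℝ) :
    mutualInfo P K = condDivergence P K fun _ => outputDist P K := by
  simp only [mutualInfo, condDivergence, relEntropy, mul_sum, mul_assoc]

variable {P : S → ℝ} {K : S → Sh → ℝ}

theorem mutualInfo_nonneg (hP : P ∈ stdSimplex ℝ S) (hK : IsKernel K) : 0 ≤ mutualInfo P K := by
  rw [mutualInfo_eq_condDivergence]
  refine sum_nonneg fun s _ => ?_
  rcases eq_or_ne (P s) 0 with hs | hs
  · simp [hs]
  exact mul_nonneg (hP.1 s) (relEntropy_nonneg (hK s) (outputDist_mem_stdSimplex hP hK)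
    fun _ => eq_zero_of_outputDist_eq_zero hP.1 hK.nonneg hs)

theorem convexOn_mutualInfo (hP : 0 ≤ P) :
    ConvexOn ℝ {K : S → Sh → ℝ | IsKernel K} (mutualInfo P) := by
  refine ⟨convex_setOf_isKernel, fun K hK K' hK' a b ha hb _ => ?_⟩
  have hK0 : 0 ≤ K := IsKernel.nonneg hK
  have hK'0 : 0 ≤ K' := IsKernel.nonneg hK'
  simp only [mutualInfo_eq_condDivergence, condDivergence, outputDist_smul_add_smul, smul_eq_mul]
  rw [mul_sum, mul_sum, ← sum_add_distrib]
  refine sum_le_sum fun s _ => ?_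
  rcases eq_or_ne (P s) 0 with hs | hs
  · simp [hs]
  have hconv := relEntropy_convex (hK0 s) (hK'0 s) (outputDist_nonneg hP hK0)
    (outputDist_nonneg hP hK'0) (fun _ => eq_zero_of_outputDist_eq_zero hP hK0 hs)
    (fun _ => eq_zero_of_outputDist_eq_zero hP hK'0 hs) ha hb
  exact (mul_le_mul_of_nonneg_left hconv (hP s)).trans_eq (by ring)

theorem condDivergence_const_eq_mutualInfo_add (hP : 0 ≤ P) (hK : 0 ≤ K) {q : Sh → ℝ}
    (hq : ∀ s sh, P s ≠ 0 → q sh = 0 → K s sh = 0) :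
    condDivergence P K (fun _ => q) = mutualInfo P K + relEntropy (outputDist P K) q := by
  have hterm (s : S) (sh : Sh) : P s * (K s sh * Real.log (K s sh / q sh)) =
      P s * K s sh * Real.log (K s sh / outputDist P K sh) +
        P s * K s sh * Real.log (outputDist P K sh / q sh) := by
    rcases eq_or_ne (P s) 0 with hs | hs
    · simp [hs]
    rcases eq_or_ne (K s sh) 0 with hKs | hKs
    · simp [hKs]
    have hout : outputDist P K sh ≠ 0 := mt (eq_zero_of_outputDist_eq_zero hP hK hs) hKs
    rw [← mul_add, ← Real.log_mul (div_ne_zero hKs hout)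
      (div_ne_zero hout (mt (hq s sh hs) hKs)), div_mul_div_cancel₀ hout, mul_assoc]
  simp only [condDivergence, relEntropy, mutualInfo, mul_sum, hterm, sum_add_distrib]
  congr 1
  rw [sum_comm]
  exact sum_congr rfl fun sh _ => (sum_mul univ (fun s => P s * K s sh) _).symm

theorem mutualInfo_le_condDivergence (hP : P ∈ stdSimplex ℝ S) (hK : IsKernel K) {q : Sh → ℝ}
    (hq : q ∈ stdSimplex ℝ Sh) (hKq : ∀ s sh, P s ≠ 0 → q sh = 0 → K s sh = 0) :
    mutualInfo P K ≤ condDivergence P K fun _ => q := by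
  rw [condDivergence_const_eq_mutualInfo_add hP.1 hK.nonneg hKq]
  refine le_add_of_nonneg_right (relEntropy_nonneg (outputDist_mem_stdSimplex hP hK) hq
    fun sh hsh => sum_eq_zero fun s _ => mul_eq_zero.2 ?_)
  exact or_iff_not_imp_left.2 fun hs => hKq s sh hs hsh

theorem neg_sum_mul_log_sum_le_condDivergence (hP : 0 ≤ P) (hK : IsKernel K)
    {w : S → Sh → ℝ} (hw : 0 ≤ w) (hKw : ∀ s sh, P s ≠ 0 → w s sh = 0 → K s sh = 0) :
    -∑ s, P s * Real.log (∑ sh, w s sh) ≤ condDivergence P K w := by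
  rw [← sum_neg_distrib]
  refine sum_le_sum fun s _ => ?_
  rcases eq_or_ne (P s) 0 with hs | hs
  · simp [hs]
  have hlogsum := sum_mul_log_sum_div_sum_le_relEntropy (hK.nonneg s) (hw s) (hKw s · hs)
  rw [hK.sum_eq_one, one_mul, one_div, Real.log_inv] at hlogsum
  linarith [mul_le_mul_of_nonneg_left hlogsum (hP s)]

theorem condDivergence_gibbsKernel (q : Sh → ℝ) {w : S → Sh → ℝ}
    (hw : ∀ s, P s ≠ 0 → ∑ sh, w s sh ≠ 0) :
    condDivergence P (gibbsKernel q w) w = -∑ s, P s * Real.log (∑ sh, w s sh) := by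
  rw [← sum_neg_distrib]
  refine sum_congr rfl fun s _ => ?_
  rcases eq_or_ne (P s) 0 with hs | hs
  · simp [hs]
  rw [gibbsKernel_of_sum_ne_zero q (hw s hs), relEntropy_smul_self (inv_mul_cancel₀ (hw s hs)),
    Real.log_inv, mul_neg]

end MutualInfo

section Distortion

variable {S Sh : Type*} [Fintype S] [Fintype Sh] {P : S → ℝ} {d : S → Sh → ℝ≥0∞}
  {K K' : S → Sh → ℝ} {D : ℝ}

theorem expectedDistortion_ne_top_iff :
    expectedDistortion P d K ≠ ⊤ ↔ ∀ s sh, 0 < P s * K s sh → d s sh ≠ ⊤ := by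
  simp only [expectedDistortion, ne_eq, ENNReal.sum_eq_top, mem_univ, true_and, not_exists,
    ENNReal.mul_eq_top, ENNReal.ofReal_eq_zero, ENNReal.ofReal_ne_top, false_and, or_false,
    not_and, not_le]

theorem toReal_expectedDistortion (hP : 0 ≤ P) (hK : 0 ≤ K)
    (hd : expectedDistortion P d K ≠ ⊤) :
    (expectedDistortion P d K).toReal = ∑ s, P s * ∑ sh, K s sh * (d s sh).toReal := by
  rw [expectedDistortion, ENNReal.sum_ne_top] at hd
  rw [expectedDistortion, ENNReal.toReal_sum hd]
  refine sum_congr rfl fun s _ => ?_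
  rw [ENNReal.toReal_sum (ENNReal.sum_ne_top.1 (hd s (mem_univ s))), mul_sum]
  refine sum_congr rfl fun sh _ => ?_
  rw [ENNReal.toReal_mul, ENNReal.toReal_ofReal (mul_nonneg (hP s) (hK s sh)), mul_assoc]

theorem expectedDistortion_smul_add_smul (hP : 0 ≤ P) (hK : 0 ≤ K) (hK' : 0 ≤ K') {a b : ℝ}
    (ha : 0 ≤ a) (hb : 0 ≤ b) :
    expectedDistortion P d (a • K + b • K') =
      ENNReal.ofReal a * expectedDistortion P d K +
        ENNReal.ofReal b * expectedDistortion P d K' := by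
  simp only [expectedDistortion, mul_sum, ← sum_add_distrib]
  refine sum_congr rfl fun s _ => sum_congr rfl fun sh _ => ?_
  rw [← mul_assoc, ← mul_assoc, ← ENNReal.ofReal_mul ha, ← ENNReal.ofReal_mul hb, ← add_mul,
    ← ENNReal.ofReal_add (mul_nonneg ha (mul_nonneg (hP s) (hK s sh)))
      (mul_nonneg hb (mul_nonneg (hP s) (hK' s sh)))]
  simp only [Pi.add_apply, Pi.smul_apply, smul_eq_mul]
  ring_nf

theorem isTestChannel_iff :
    IsTestChannel P d D K ↔
      IsKernel K ∧ expectedDistortion P d K ≠ ⊤ ∧ (expectedDistortion P d K).toReal ≤ D := by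
  refine and_congr_right fun _ => ?_
  induction expectedDistortion P d K with
  | top => simp
  | coe e => simp [EReal.coe_nnreal_eq_coe_real]

theorem IsTestChannel.mono {D' : ℝ} (hK : IsTestChannel P d D K) (h : D ≤ D') :
    IsTestChannel P d D' K :=
  ⟨hK.1, hK.2.trans (EReal.coe_le_coe_iff.2 h)⟩

theorem toReal_rateDistortion_le (hP : P ∈ stdSimplex ℝ S) (hK : IsTestChannel P d D K) :
    (rateDistortion P d D).toReal ≤ mutualInfo P K := by
  have hnonneg : 0 ≤ rateDistortion P d D :=
    le_iInf₂ fun K' hK' => EReal.coe_nonneg.2 (mutualInfo_nonneg hP hK'.1)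
  exact EReal.toReal_le_toReal (iInf₂_le K hK) (EReal.bot_lt_zero.trans_le hnonneg).ne'
    (EReal.coe_ne_top _)

theorem IsOptimalTestChannel.toReal_rateDistortion (hK : IsOptimalTestChannel P d D K) :
    (rateDistortion P d D).toReal = mutualInfo P K := by
  rw [← hK.2, EReal.toReal_coe]

end Distortion

section FirstOrder

theorem mul_le_of_forall_le_add_mul {f : ℝ → ℝ} {f' x h c : ℝ} (hf : HasDerivAt f f' x)
    (hle : ∀ t ∈ Set.Ioo (0 : ℝ) 1, f (x + t * h) ≤ f x + t * c) : f' * h ≤ c := by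
  have hline : HasDerivAt (fun t => f (x + t * h)) (f' * h) 0 := by
    have hinner : HasDerivAt (fun t => x + t * h) h 0 := by
      simpa using ((hasDerivAt_id (0 : ℝ)).mul_const h).const_add x
    exact HasDerivAt.comp (0 : ℝ) (by simpa using hf) hinner
  refine le_of_tendsto hline.tendsto_slope_zero_right ?_
  filter_upwards [Ioo_mem_nhdsGT (zero_lt_one' ℝ)] with t ht
  rw [smul_eq_mul, inv_mul_le_iff₀ ht.1]
  simpa only [zero_add, zero_mul, add_zero, sub_le_iff_le_add'] using hle t ht

theorem sum_mul_div_le_sum_of_sum_mul_log_le {S : Type*} [Fintype S] {P z e : S → ℝ}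
    (hz : ∀ s, P s ≠ 0 → z s ≠ 0)
    (h : ∀ t ∈ Set.Ioo (0 : ℝ) 1,
      ∑ s, P s * Real.log ((1 - t) * z s + t * e s) ≤ ∑ s, P s * Real.log (z s)) :
    ∑ s, P s * (e s / z s) ≤ ∑ s, P s := by
  have hderiv : HasDerivAt (fun t => ∑ s, P s * Real.log ((1 - t) * z s + t * e s))
      (∑ s, P s * ((e s - z s) / z s)) 0 := by
    refine HasDerivAt.fun_sum fun s _ => ?_
    rcases eq_or_ne (P s) 0 with hs | hs
    · simpa [hs] using hasDerivAt_const (0 : ℝ) (0 : ℝ)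
    have hline : HasDerivAt (fun t => (1 - t) * z s + t * e s) (e s - z s) 0 :=
      ((((hasDerivAt_id' (0 : ℝ)).const_sub 1).mul_const (z s)).fun_add
        ((hasDerivAt_id' (0 : ℝ)).mul_const (e s))).congr_deriv (by ring)
    simpa using (hline.log (by simpa using hz s hs)).const_mul (P s)
  have hslope := mul_le_of_forall_le_add_mul (h := 1) (c := 0) hderiv fun t ht => by
    simpa using h t ht
  have hsplit (s : S) : P s * ((e s - z s) / z s) = P s * (e s / z s) - P s := by
    rcases eq_or_ne (P s) 0 with hs | hs
    · simp [hs]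
    · rw [sub_div, div_self (hz s hs), mul_sub, mul_one]
  simpa only [hsplit, sum_sub_distrib, mul_one, sub_nonpos] using hslope

end FirstOrder

section Lagrangian

variable {S Sh : Type*} [Fintype S] [Fintype Sh] {P : S → ℝ} {d : S → Sh → ℝ≥0∞}
  {K : S → Sh → ℝ} {D : ℝ}

/-- The kernels over which the Lagrangian of the rate-distortion problem is minimized. Infinite
expected distortion is excluded because its `toReal` is `0`. -/
def finiteDistortionKernels (P : S → ℝ) (d : S → Sh → ℝ≥0∞) : Set (S → Sh → ℝ) :=
  {K | IsKernel K ∧ expectedDistortion P d K ≠ ⊤}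

/-- The Lagrangian `I(S; Ŝ) + l 𝔼[d(S, Ŝ)]` of the rate-distortion problem, for kernels in
`finiteDistortionKernels`. -/
noncomputable def lagrangian (P : S → ℝ) (d : S → Sh → ℝ≥0∞) (l : ℝ) (K : S → Sh → ℝ) : ℝ :=
  mutualInfo P K + l * (expectedDistortion P d K).toReal

theorem IsOptimalTestChannel.mem_finiteDistortionKernels (hK : IsOptimalTestChannel P d D K) :
    K ∈ finiteDistortionKernels P d :=
  ⟨hK.1.1, (isTestChannel_iff.1 hK.1).2.1⟩

theorem hasDerivAt_toReal_rateDistortion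
    (hd : DifferentiableAt ℝ (fun r : ℝ => (rateDistortion P d r).toReal) D) :
    HasDerivAt (fun r : ℝ => (rateDistortion P d r).toReal) (-lamStar P d D) D := by
  rw [lamStar, neg_neg]
  exact hd.hasDerivAt

theorem IsOptimalTestChannel.lamStar_nonneg (hK : IsOptimalTestChannel P d D K)
    (hP : P ∈ stdSimplex ℝ S)
    (hd : DifferentiableAt ℝ (fun r : ℝ => (rateDistortion P d r).toReal) D) :
    0 ≤ lamStar P d D := by
  have hantitone : -lamStar P d D * 1 ≤ 0 := by
    refine mul_le_of_forall_le_add_mul (hasDerivAt_toReal_rateDistortion hd) fun t ht => ?_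
    rw [hK.toReal_rateDistortion, mul_zero, add_zero]
    exact toReal_rateDistortion_le hP (hK.1.mono (by linarith [ht.1]))
  linarith

theorem IsOptimalTestChannel.isMinOn_lagrangian (hK : IsOptimalTestChannel P d D K)
    (hP : P ∈ stdSimplex ℝ S)
    (hd : DifferentiableAt ℝ (fun r : ℝ => (rateDistortion P d r).toReal) D) :
    IsMinOn (lagrangian P d (lamStar P d D)) (finiteDistortionKernels P d) K := by
  refine isMinOn_iff.2 fun K' ⟨hK', hE'⟩ => ?_
  obtain ⟨hKker, hE, hED⟩ := isTestChannel_iff.1 hK.1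
  have hslope : -lamStar P d D * ((expectedDistortion P d K').toReal - D) ≤
      mutualInfo P K' - mutualInfo P K := by
    refine mul_le_of_forall_le_add_mul (hasDerivAt_toReal_rateDistortion hd) fun t ht => ?_
    have ht' : 0 ≤ 1 - t := sub_nonneg.2 ht.2.le
    have hmix : IsTestChannel P d (D + t * ((expectedDistortion P d K').toReal - D))
        ((1 - t) • K + t • K') := by
      refine isTestChannel_iff.2
        ⟨convex_setOf_isKernel hKker hK' ht' ht.1.le (sub_add_cancel 1 t), ?_⟩
      rw [expectedDistortion_smul_add_smul hP.1 hKker.nonneg hK'.nonneg ht' ht.1.le]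
      have htop := ENNReal.mul_ne_top (ENNReal.ofReal_ne_top (r := 1 - t)) hE
      have htop' := ENNReal.mul_ne_top (ENNReal.ofReal_ne_top (r := t)) hE'
      refine ⟨ENNReal.add_ne_top.2 ⟨htop, htop'⟩, ?_⟩
      rw [ENNReal.toReal_add htop htop', ENNReal.toReal_mul, ENNReal.toReal_mul,
        ENNReal.toReal_ofReal ht', ENNReal.toReal_ofReal ht.1.le]
      linarith [mul_le_mul_of_nonneg_left hED ht']
    have hconv := (convexOn_mutualInfo hP.1).2 hKker hK' ht' ht.1.le (sub_add_cancel 1 t)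
    rw [smul_eq_mul, smul_eq_mul] at hconv
    rw [hK.toReal_rateDistortion]
    linarith [toReal_rateDistortion_le hP hmix]
  unfold lagrangian
  linarith [mul_le_mul_of_nonneg_left hED (hK.lamStar_nonneg hP hd)]

end Lagrangian

section Partition

theorem expTilt_of_ne_top (l D : ℝ) {δ : ℝ≥0∞} (h : δ ≠ ⊤) :
    expTilt l D δ = Real.exp (l * D - l * δ.toReal) :=
  if_neg h

theorem expTilt_nonneg (l D : ℝ) (δ : ℝ≥0∞) : 0 ≤ expTilt l D δ := by
  unfold expTilt
  split_ifs <;> positivity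

theorem expTilt_ne_zero_iff {l D : ℝ} {δ : ℝ≥0∞} : expTilt l D δ ≠ 0 ↔ δ ≠ ⊤ :=
  ⟨fun h hδ => h (if_pos hδ), fun h => by rw [expTilt_of_ne_top l D h]; exact Real.exp_ne_zero _⟩

variable {S Sh : Type*}

/-- The weights `q(ŝ) exp(l D - l d(s, ŝ))`, whose Gibbs channel minimizes
`D(K ‖ q | P) + l 𝔼[d(S, Ŝ)]` over the channels `K`. -/
noncomputable def tiltWeight (d : S → Sh → ℝ≥0∞) (l D : ℝ) (q : Sh → ℝ) (s : S) (sh : Sh) : ℝ :=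
  q sh * expTilt l D (d s sh)

theorem tiltWeight_nonneg (d : S → Sh → ℝ≥0∞) (l D : ℝ) {q : Sh → ℝ} (hq : 0 ≤ q) :
    0 ≤ tiltWeight d l D q :=
  fun s sh => mul_nonneg (hq sh) (expTilt_nonneg l D (d s sh))

variable [Fintype Sh]

/-- The partition function `𝔼[exp(l D - l d(s, Ŝ))]` for `Ŝ` distributed as `q`. -/
noncomputable def partition (d : S → Sh → ℝ≥0∞) (l D : ℝ) (q : Sh → ℝ) (s : S) : ℝ :=
  ∑ sh, tiltWeight d l D q s sh

theorem partition_smul_add_smul_single [DecidableEq Sh] (d : S → Sh → ℝ≥0∞) (l D : ℝ)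
    (q : Sh → ℝ) (a b : ℝ) (s : S) (sh : Sh) :
    partition d l D (a • q + b • Pi.single sh 1) s =
      a * partition d l D q s + b * expTilt l D (d s sh) := by
  simp [partition, tiltWeight, add_mul, sum_add_distrib, mul_assoc, mul_sum, Pi.single_apply]

variable [Fintype S] {P : S → ℝ} {d : S → Sh → ℝ≥0∞} {K : S → Sh → ℝ}

theorem partition_outputDist_pos (hP : 0 ≤ P) (hK : K ∈ finiteDistortionKernels P d) (l D : ℝ)
    {s : S} (hs : P s ≠ 0) : 0 < partition d l D (outputDist P K) s := by
  have hKnn : 0 ≤ K := hK.1.nonneg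
  obtain ⟨sh, -, hsh⟩ : ∃ sh ∈ univ, K s sh ≠ 0 :=
    exists_ne_zero_of_sum_ne_zero ((hK.1.sum_eq_one s).trans_ne one_ne_zero)
  have hdsh : d s sh ≠ ⊤ := expectedDistortion_ne_top_iff.1 hK.2 s sh
    (mul_pos ((hP s).lt_of_ne' hs) ((hKnn s sh).lt_of_ne' hsh))
  have hq : outputDist P K sh ≠ 0 := mt (eq_zero_of_outputDist_eq_zero hP hKnn hs) hsh
  have hweight := tiltWeight_nonneg d l D (outputDist_nonneg hP hKnn)
  refine sum_pos' (fun sh _ => hweight s sh) ⟨sh, mem_univ sh, (hweight s sh).lt_of_ne' ?_⟩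
  exact mul_ne_zero hq (expTilt_ne_zero_iff.2 hdsh)

theorem condDivergence_tiltWeight (hP : P ∈ stdSimplex ℝ S)
    (hK : K ∈ finiteDistortionKernels P d) (l D : ℝ) {q : Sh → ℝ}
    (hq : ∀ s sh, P s ≠ 0 → q sh = 0 → K s sh = 0) :
    condDivergence P K (tiltWeight d l D q) =
      condDivergence P K (fun _ => q) + l * ((expectedDistortion P d K).toReal - D) := by
  have hKnn : 0 ≤ K := hK.1.nonneg
  have hterm (s : S) (hs : P s ≠ 0) (sh : Sh) :
      K s sh * Real.log (K s sh / tiltWeight d l D q s sh) =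
        K s sh * Real.log (K s sh / q sh) + (l * (K s sh * (d s sh).toReal) - l * D * K s sh) := by
    rcases eq_or_ne (K s sh) 0 with hKs | hKs
    · simp [hKs]
    have hdsh : d s sh ≠ ⊤ := expectedDistortion_ne_top_iff.1 hK.2 s sh
      (mul_pos ((hP.1 s).lt_of_ne' hs) ((hKnn s sh).lt_of_ne' hKs))
    rw [tiltWeight, ← div_div, Real.log_div (div_ne_zero hKs (mt (hq s sh hs) hKs))
      (expTilt_ne_zero_iff.2 hdsh), expTilt_of_ne_top l D hdsh, Real.log_exp]
    ring
  have hrow (s : S) : P s * relEntropy (K s) (tiltWeight d l D q s) =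
      P s * relEntropy (K s) q +
        (l * (P s * ∑ sh, K s sh * (d s sh).toReal) - l * D * P s) := by
    rcases eq_or_ne (P s) 0 with hs | hs
    · simp [hs]
    simp only [relEntropy, hterm s hs, sum_add_distrib, sum_sub_distrib, ← mul_sum,
      hK.1.sum_eq_one]
    ring
  simp only [condDivergence, hrow, sum_add_distrib, sum_sub_distrib, ← mul_sum, hP.2,
    toReal_expectedDistortion hP.1 hKnn hK.2]
  ring

theorem gibbsKernel_tiltWeight_mem_finiteDistortionKernels (l D : ℝ) {q : Sh → ℝ}
    (hq : q ∈ stdSimplex ℝ Sh) (hZ : ∀ s, P s ≠ 0 → partition d l D q s ≠ 0) :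
    gibbsKernel q (tiltWeight d l D q) ∈ finiteDistortionKernels P d := by
  refine ⟨isKernel_gibbsKernel hq (tiltWeight_nonneg d l D hq.1),
    expectedDistortion_ne_top_iff.2 fun s sh hpos => ?_⟩
  have hs : P s ≠ 0 := left_ne_zero_of_mul hpos.ne'
  have hweight := right_ne_zero_of_mul hpos.ne'
  rw [gibbsKernel_of_sum_ne_zero q (hZ s hs)] at hweight
  exact expTilt_ne_zero_iff.1 (right_ne_zero_of_mul (right_ne_zero_of_mul hweight))

theorem lagrangian_gibbsKernel_le (hP : P ∈ stdSimplex ℝ S) (l D : ℝ) {q : Sh → ℝ}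
    (hq : q ∈ stdSimplex ℝ Sh) (hZ : ∀ s, P s ≠ 0 → partition d l D q s ≠ 0) :
    lagrangian P d l (gibbsKernel q (tiltWeight d l D q)) ≤
      l * D - ∑ s, P s * Real.log (partition d l D q s) := by
  set G := gibbsKernel q (tiltWeight d l D q)
  have hG : G ∈ finiteDistortionKernels P d :=
    gibbsKernel_tiltWeight_mem_finiteDistortionKernels l D hq hZ
  have hGq (s : S) (sh : Sh) (hs : P s ≠ 0) (hqsh : q sh = 0) : G s sh = 0 := by
    simp [G, gibbsKernel_of_sum_ne_zero q (hZ s hs), tiltWeight, hqsh]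
  have htilt := condDivergence_tiltWeight hP hG l D hGq
  rw [condDivergence_gibbsKernel q hZ] at htilt
  have hmutual := mutualInfo_le_condDivergence hP hG.1 hq hGq
  unfold lagrangian
  unfold partition
  linarith

theorem sub_sum_mul_log_partition_le_lagrangian (hP : P ∈ stdSimplex ℝ S)
    (hK : K ∈ finiteDistortionKernels P d) (l D : ℝ) :
    l * D - ∑ s, P s * Real.log (partition d l D (outputDist P K) s) ≤ lagrangian P d l K := by
  have hKnn : 0 ≤ K := hK.1.nonneg
  have hKq (s : S) (sh : Sh) (hs : P s ≠ 0) : outputDist P K sh = 0 → K s sh = 0 :=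
    eq_zero_of_outputDist_eq_zero hP.1 hKnn hs
  have hKw (s : S) (sh : Sh) (hs : P s ≠ 0)
      (hw : tiltWeight d l D (outputDist P K) s sh = 0) : K s sh = 0 := by
    by_contra hKs
    have hdsh := expectedDistortion_ne_top_iff.1 hK.2 s sh
      (mul_pos ((hP.1 s).lt_of_ne' hs) ((hKnn s sh).lt_of_ne' hKs))
    exact hKs (hKq s sh hs ((mul_eq_zero.1 hw).resolve_right (expTilt_ne_zero_iff.2 hdsh)))
  have hgibbs := neg_sum_mul_log_sum_le_condDivergence hP.1 hK.1
    (tiltWeight_nonneg d l D (outputDist_nonneg hP.1 hKnn)) hKw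
  rw [condDivergence_tiltWeight hP hK l D hKq, ← mutualInfo_eq_condDivergence] at hgibbs
  unfold lagrangian
  unfold partition
  linarith

theorem sum_mul_log_partition_le (hP : P ∈ stdSimplex ℝ S) {l : ℝ}
    (hK : K ∈ finiteDistortionKernels P d)
    (hmin : IsMinOn (lagrangian P d l) (finiteDistortionKernels P d) K) (D : ℝ) {q : Sh → ℝ}
    (hq : q ∈ stdSimplex ℝ Sh) (hZ : ∀ s, P s ≠ 0 → partition d l D q s ≠ 0) :
    ∑ s, P s * Real.log (partition d l D q s) ≤
      ∑ s, P s * Real.log (partition d l D (outputDist P K) s) := by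
  have hGK := isMinOn_iff.1 hmin _ (gibbsKernel_tiltWeight_mem_finiteDistortionKernels l D hq hZ)
  linarith [lagrangian_gibbsKernel_le hP l D hq hZ,
    sub_sum_mul_log_partition_le_lagrangian hP hK l D]

theorem sum_mul_expTilt_div_partition_le_one (hP : P ∈ stdSimplex ℝ S) {l : ℝ}
    (hK : K ∈ finiteDistortionKernels P d)
    (hmin : IsMinOn (lagrangian P d l) (finiteDistortionKernels P d) K) (D : ℝ) (sh : Sh) :
    ∑ s, P s * (expTilt l D (d s sh) / partition d l D (outputDist P K) s) ≤ 1 := by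
  classical
  rw [← hP.2]
  have hZ (s : S) (hs : P s ≠ 0) := partition_outputDist_pos hP.1 hK l D hs
  refine sum_mul_div_le_sum_of_sum_mul_log_le (fun s hs => (hZ s hs).ne') fun t ht => ?_
  simp only [← partition_smul_add_smul_single]
  refine sum_mul_log_partition_le hP hK hmin D
    (convex_stdSimplex ℝ Sh (outputDist_mem_stdSimplex hP hK.1) (single_mem_stdSimplex ℝ sh)
      (sub_nonneg.2 ht.2.le) ht.1.le (sub_add_cancel 1 t)) fun s hs => ?_
  rw [partition_smul_add_smul_single]
  exact (add_pos_of_pos_of_nonneg (mul_pos (sub_pos.2 ht.2) (hZ s hs))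
    (mul_nonneg ht.1.le (expTilt_nonneg l D (d s sh)))).ne'

end Partition

section Cover

variable {S X Y Sh : Type*} [Fintype S] [Fintype Y] [Fintype Sh]

theorem ind_le_expTilt {l : ℝ} (hl : 0 ≤ l) (D : ℝ≥0) (δ : ℝ≥0∞) :
    ind (δ ≤ (D : ℝ≥0∞)) ≤ expTilt l D δ := by
  by_cases h : δ ≤ (D : ℝ≥0∞)
  · rw [ind_of_true h, expTilt_of_ne_top l D (ne_top_of_le_ne_top ENNReal.coe_ne_top h)]
    exact Real.one_le_exp (sub_nonneg.2
      (mul_le_mul_of_nonneg_left (ENNReal.toReal_le_coe_of_le_coe h) hl))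
  · rw [ind_of_false h]
    exact expTilt_nonneg l D δ

theorem coverTerm_le_exp_neg_of_sum_le_one {P : S → ℝ} {d : S → Sh → ℝ≥0∞} {D : ℝ≥0} {sh : Sh}
    (h : ∑ s, P s * (Real.exp (tiltedInfo P d D s) * ind (d s sh ≤ (D : ℝ≥0∞))) ≤ 1) (γ : ℝ) :
    coverTerm P d D γ sh ≤ Real.exp (-γ) := by
  calc coverTerm P d D γ sh = Real.exp (-γ) *
        ∑ s, P s * (Real.exp (tiltedInfo P d D s) * ind (d s sh ≤ (D : ℝ≥0∞))) := by
        rw [coverTerm, mul_sum]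
        refine sum_congr rfl fun s _ => ?_
        rw [sub_eq_add_neg, Real.exp_add]
        ring
    _ ≤ Real.exp (-γ) := mul_le_of_le_one_right (Real.exp_pos _).le h

theorem isOptimalTestChannel_optimalTestChannel {P : S → ℝ} {d : S → Sh → ℝ≥0∞} {D : ℝ}
    (h : ∃ K, IsOptimalTestChannel P d D K) :
    IsOptimalTestChannel P d D (optimalTestChannel P d D) := by
  rw [optimalTestChannel, dif_pos h]
  exact h.choose_spec

theorem coverTerm_le_exp_neg {P : S → ℝ} (hP : P ∈ stdSimplex ℝ S) {d : S → Sh → ℝ≥0∞} {D : ℝ≥0}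
    (hD : D ≠ 0) (hopt : ∃ K, IsOptimalTestChannel P d D K)
    (hd : DifferentiableAt ℝ (fun r : ℝ => (rateDistortion P d r).toReal) D) (γ : ℝ) (sh : Sh) :
    coverTerm P d D γ sh ≤ Real.exp (-γ) := by
  have hK := isOptimalTestChannel_optimalTestChannel hopt
  have hKfin := hK.mem_finiteDistortionKernels
  refine coverTerm_le_exp_neg_of_sum_le_one (le_trans (sum_le_sum fun s _ => ?_)
    (sum_mul_expTilt_div_partition_le_one hP hKfin (hK.isMinOn_lagrangian hP hd) D sh)) γ
  rcases eq_or_ne (P s) 0 with hs | hs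
  · simp [hs]
  have hZ := partition_outputDist_pos hP.1 hKfin (lamStar P d D) D hs
  have htilted : Real.exp (tiltedInfo P d D s) =
      1 / partition d (lamStar P d D) D (outputDist P (optimalTestChannel P d D)) s := by
    rw [tiltedInfo, if_neg hD]
    exact Real.exp_log (one_div_pos.2 hZ)
  rw [htilted, one_div_mul_eq_div]
  exact mul_le_mul_of_nonneg_left (div_le_div_of_nonneg_right
    (ind_le_expTilt (hK.lamStar_nonneg hP hd) D _) hZ.le) (hP.1 s)

theorem coverTerm_zero_le_exp_neg {P : S → ℝ} (hP : 0 ≤ P) {d : S → Sh → ℝ≥0∞} {sh : Sh}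
    (h : ∀ s s', 0 < P s → 0 < P s' → d s sh = 0 → d s' sh = 0 → s = s') (γ : ℝ) :
    coverTerm P d 0 γ sh ≤ Real.exp (-γ) := by
  refine coverTerm_le_exp_neg_of_sum_le_one ?_ γ
  have hzero (s : S) (hs : ¬(0 < P s ∧ d s sh = 0)) :
      P s * (Real.exp (tiltedInfo P d 0 s) * ind (d s sh ≤ ((0 : ℝ≥0) : ℝ≥0∞))) = 0 := by
    rcases (hP s).eq_or_lt with hPs | hPs
    · rw [← hPs, Pi.zero_apply, zero_mul]
    · rw [ind_of_false (by simpa using fun hds => hs ⟨hPs, hds⟩), mul_zero, mul_zero]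
  by_cases hcovered : ∃ s, 0 < P s ∧ d s sh = 0
  · obtain ⟨s, hs, hds⟩ := hcovered
    rw [sum_eq_single s (fun s' _ hne => hzero s' fun hs' => hne (h s' s hs'.1 hs hs'.2 hds))
        (by simp),
      tiltedInfo, if_pos rfl, Real.exp_log (one_div_pos.2 hs), ind_of_true (by simp [hds]),
      mul_one, mul_one_div_cancel hs.ne']
  · rw [sum_eq_zero fun s _ => hzero s (not_exists.1 hcovered s)]
    exact zero_le_one

theorem oldValue_le_newValue [Nonempty Sh] {P : S → ℝ} {d : S → Sh → ℝ≥0∞} {D : ℝ≥0} {γ : ℝ}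
    (h : ∀ sh, coverTerm P d D γ sh ≤ Real.exp (-γ)) {W : X → Y → ℝ} {T : ℕ}
    (A : Auxiliary W T) : oldValue P d D γ A ≤ newValue P d D γ A :=
  sub_le_sub_left (mul_le_mul_of_nonneg_left (ciSup_le h) T.cast_nonneg) _

end Cover

end JSCC

theorem mainTheorem5_general {S X Y Sh : Type*} [Fintype S] [Fintype X] [Fintype Y] [Fintype Sh]
    [Nonempty X] [Nonempty Sh]
    (P : S → ℝ) (hP : P ∈ stdSimplex ℝ S)
    (W : X → Y → ℝ) (d : S → Sh → ℝ≥0∞) (D : ℝ≥0)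
    (hD : D = 0 ∨ (∃ K, IsOptimalTestChannel P d D K) ∧
      DifferentiableAt ℝ (fun r : ℝ => (rateDistortion P d r).toReal) D) :
    (∀ (f : S → X) (g : Y → Sh),
      optSC P W (excessLoss X Y d D) ≤
        ((codeLoss P W (excessLoss X Y d D) f g : ℝ) : EReal)) ∧
    (∀ (Q : S → X → ℝ) (R : Y → Sh → ℝ), IsKernel Q → IsKernel R →
      optSC P W (excessLoss X Y d D) ≤
        ((expectedLoss P W (excessLoss X Y d D) Q R : ℝ) : EReal)) ∧
    optDP P W (excessLoss X Y d D) ≤ optSC P W (excessLoss X Y d D) ∧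
    newBound P W d D ≤ optDP P W (excessLoss X Y d D) ∧
    (∀ (γ : ℝ) (T : ℕ), 0 < T → ∀ A : Auxiliary W T,
      (dualPoint P d D γ A).Feasible P W (excessLoss X Y d D) ∧
      (dualPoint P d D γ A).objective = newValue P d D γ A ∧
      ∀ γb : Y → ℝ,
        DualPoint.Feasible P W (excessLoss X Y d D) { dualPoint P d D γ A with γb := γb } →
        ∀ y, γb y ≤ (dualPoint P d D γ A).γb y) ∧
    ((D = 0 → ∀ (sh : Sh) (s s' : S), 0 < P s → 0 < P s' →
        d s sh = 0 → d s' sh = 0 → s = s') →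
      (∀ (γ : ℝ) (T : ℕ), 0 < T → ∀ A : Auxiliary W T,
        oldValue P d D γ A ≤ newValue P d D γ A) ∧
      oldBound P W d D ≤ newBound P W d D) := by
  refine ⟨optSC_le_codeLoss P W _, fun Q R hQ hR => optSC_le_expectedLoss P W _ hQ hR,
    optDP_le_optSC P W _, newBound_le_optDP hP.1 W d D, fun γ T _ A =>
      ⟨dualPoint_feasible hP.1 d D γ A, dualPoint_objective hP.1 d D γ A,
        fun γb h y => le_dualPoint_γb h y⟩, fun hzero => ?_⟩
  have hcover (γ : ℝ) (sh : Sh) : coverTerm P d D γ sh ≤ Real.exp (-γ) := by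
    rcases eq_or_ne D 0 with rfl | hD0
    · exact coverTerm_zero_le_exp_neg hP.1 (hzero rfl sh) γ
    · obtain ⟨hopt, hdiff⟩ := hD.resolve_left hD0
      exact coverTerm_le_exp_neg hP hD0 hopt hdiff γ sh
  exact ⟨fun γ T _ A => oldValue_le_newValue (hcover γ) A,
    iSup₂_mono fun γ T => iSup₂_mono fun _ A =>
      EReal.coe_le_coe_iff.2 (oldValue_le_newValue (hcover γ) A)⟩

theorem mainTheorem5 {S X Y Sh : Type*} [Fintype S] [Fintype X] [Fintype Y] [Fintype Sh]
    [Nonempty X] [Nonempty Sh]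
    (P : S → ℝ) (hP : P ∈ stdSimplex ℝ S)
    (W : X → Y → ℝ) (hW : IsKernel W)
    (d : S → Sh → ℝ≥0∞) (D : ℝ≥0)
    (hD : D = 0 ∨ TiltedRegular P d D) :
    -- every deterministic and every randomized code
    (∀ (f : S → X) (g : Y → Sh),
      optSC P W (excessLoss X Y d D) ≤
        ((codeLoss P W (excessLoss X Y d D) f g : ℝ) : EReal)) ∧
    (∀ (Q : S → X → ℝ) (R : Y → Sh → ℝ), IsKernel Q → IsKernel R →
      optSC P W (excessLoss X Y d D) ≤
        ((expectedLoss P W (excessLoss X Y d D) Q R : ℝ) : EReal)) ∧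
    -- the chain of lower bounds
    optDP P W (excessLoss X Y d D) ≤ optSC P W (excessLoss X Y d D) ∧
    newBound P W d D ≤ optDP P W (excessLoss X Y d D) ∧
    -- the improved value is attained at a dual feasible point with `γb` optimal
    (∀ (γ : ℝ) (T : ℕ), 0 < T → ∀ A : Auxiliary W T,
      (dualPoint P d D γ A).Feasible P W (excessLoss X Y d D) ∧
      (dualPoint P d D γ A).objective = newValue P d D γ A ∧
      ∀ γb : Y → ℝ,
        DualPoint.Feasible P W (excessLoss X Y d D) { dualPoint P d D γ A with γb := γb } →
        ∀ y, γb y ≤ (dualPoint P d D γ A).γb y) ∧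
    -- the improvement over the earlier converse
    ((D = 0 → ∀ (sh : Sh) (s s' : S), 0 < P s → 0 < P s' →
        d s sh = 0 → d s' sh = 0 → s = s') →
      (∀ (γ : ℝ) (T : ℕ), 0 < T → ∀ A : Auxiliary W T,
        oldValue P d D γ A ≤ newValue P d D γ A) ∧
      oldBound P W d D ≤ newBound P W d D) :=
  mainTheorem5_general P hP W d D (hD.imp_right fun h => ⟨h.exists_optimal, h.differentiable⟩)
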